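/- Let $\mathcal X,\mathcal Y$ be finite sets, $Q$ a probability distribution on $\mathcal X$, $W(y|x)$ a channel from $\mathcal X$ to $\mathcal Y$ (so $W(\cdot|x)$ is a probability distribution on $\mathcal Y$ for every $x$), and $q:\mathcal X\times\mathcal Y\to[0,\infty)$ a decoding metric. Let $L\ge 0$ be an integer, $a_1,\dots,a_L:\mathcal X\to\mathbb R$, $\phi_l=\mathbb E_Q[a_l(X)]$, and $R\in\mathbb R$. Write $(Q\times W)(x,y)=Q(x)W(y|x)$, let $D(\cdot\|\cdot)$ be relative entropy in nats (with value $+\infty$ in the absence of absolute continuity), and $[c]^+=\max\{0,c\}$. Let $\mathcal S$ be the set of probability distributions $P_{XY}$ on $\mathcal X\times\mathcal Y$ with $\mathbb E_P[a_l(X)]=\phi_l$ for $l=1,\dots,L$. For $P_{XY}\in\mathcal S$ let $\mathcal T(P_{XY})$ be the set of probability distributions $\widetilde P_{XY}$ on $\mathcal X\times\mathcal Y$ with $\mathbb E_{\widetilde P}[a_l(X)]=\phi_l$ for $l=1,\dots,L$, $\widetilde P_Y=P_Y$ and $\mathbb E_{\widetilde P}[\log q(X,Y)]\ge\mathbb E_P[\log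 q(X,Y)]$, where $\log 0=-\infty$ and $0\cdot(-\infty)=0$. Then the minimum $$E_r^{\mathrm{cost}}(Q,R,\{a_l\})=\min_{P_{XY}\in\mathcal S}\ \min_{\widetilde P_{XY}\in\mathcal T(P_{XY})}\ D(P_{XY}\|Q\times W)+\big[D(\widetilde P_{XY}\|Q\times P_Y)-R\big]^+$$ is attained, and $$E_r^{\mathrm{cost}}(Q,R,\{a_l\})=\max_{\rho\in[0,1]}\ E_0^{\mathrm{cost}}(Q,\rho,\{a_l\})-\rho R$$ with the maximum attained, where $$E_0^{\mathrm{cost}}(Q,\rho,\{a_l\})=\sup_{s\ge 0,\ \{r_l\},\{\bar r_l\}\subset\mathbb R}\ -\log\mathbb E\left[\left(\frac{\mathbb E\big[q(\overline X,Y)^s e^{\sum_{l=1}^L\bar r_l(a_l(\overline X)-\phi_l)}\,\big|\,Y\big]}{q(X,Y)^s e^{\sum_{l=1}^L r_l(a_l(X)-\phi_l)}}\right)^{\rho}\right]$$ and $(X,Y,\overline X)\sim Q(x)W(y|x)Q(\bar x)$. Here $0^0=1$, a ratio whose denominator is $0$ is $+\infty$ (also when its numerator is $0$), $(+\infty)^0=1$,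 $-\log(+\infty)=-\infty$, and pairs $(x,y)$ with $Q(x)W(y|x)=0$ do not contribute to the expectation. -/

import Mathlib

/-!
Finite alphabets `X`, `Y`. A probability distribution on a finite set is an element of Mathlib's
`stdSimplex ℝ _`. All exponents take values in `EReal`, logarithms are natural.
-/

noncomputable section

namespace CostExponent

open scoped ENNReal

section Divergence

variable {α : Type*} [Fintype α]

open Classical in
/-- Relative entropy `D(P‖N) = ∑ z, P z * log (P z / N z)` of two distributions on a finite set,
with `0 log (0 / b) = 0` and with the value `+∞` if `P` is not absolutely continuous with respect
to `N`. -/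
def relEntropy (P N : α → ℝ) : EReal :=
  if ∀ z, N z = 0 → P z = 0 then ((∑ z, P z * Real.log (P z / N z) : ℝ) : EReal) else ⊤

open Classical in
/-- The extended-real expectation `E_P[log f]` for `f ≥ 0`, with `log 0 = -∞` and
`0 * (-∞) = 0`: it is `-∞` as soon as `P` charges a point at which `f` vanishes. -/
def expectLog (P f : α → ℝ) : EReal :=
  if ∀ z, f z = 0 → P z = 0 then ((∑ z, P z * Real.log (f z) : ℝ) : EReal) else ⊥

end Divergence

variable {X Y : Type*} [Fintype X] [Fintype Y] {L : ℕ}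

/-- The joint distribution `(Q × W)(x, y) = Q(x) W(y|x)`. -/
def jointDist (Q : X → ℝ) (W : X → Y → ℝ) : X × Y → ℝ := fun z => Q z.1 * W z.1 z.2

/-- The product distribution `(Q × V)(x, y) = Q(x) V(y)`. -/
def prodDist (Q : X → ℝ) (V : Y → ℝ) : X × Y → ℝ := fun z => Q z.1 * V z.2

/-- The `Y`-marginal `P_Y` of a joint distribution `P_{XY}`. -/
def marginalY (P : X × Y → ℝ) : Y → ℝ := fun y => ∑ x, P (x, y)

/-- `φ_l = E_Q[a_l(X)]`. -/
def costMean (Q : X → ℝ) (a : Fin L → X → ℝ) (l : Fin L) : ℝ := ∑ x, Q x * a l x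

/-- The set of joint distributions `P_{XY}` with `E_P[a_l(X)] = φ_l` for all `l`. -/
def setS (Y : Type*) [Fintype Y] (Q : X → ℝ) (a : Fin L → X → ℝ) : Set (X × Y → ℝ) :=
  {P | P ∈ stdSimplex ℝ (X × Y) ∧ ∀ l, ∑ z, P z * a l z.1 = costMean Q a l}

/-- The set of joint distributions `P'_{XY}` with `E_{P'}[a_l(X)] = φ_l` for all `l`,
`P'_Y = P_Y` and `E_{P'}[log q(X,Y)] ≥ E_P[log q(X,Y)]`. -/
def setT (Q : X → ℝ) (q : X → Y → ℝ) (a : Fin L → X → ℝ) (P : X × Y → ℝ) :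
    Set (X × Y → ℝ) :=
  {P' | P' ∈ stdSimplex ℝ (X × Y) ∧ (∀ l, ∑ z, P' z * a l z.1 = costMean Q a l) ∧
    marginalY P' = marginalY P ∧
    expectLog P (fun z => q z.1 z.2) ≤ expectLog P' (fun z => q z.1 z.2)}

/-- `D(P_{XY} ‖ Q × W) + [D(P'_{XY} ‖ Q × P_Y) - R]⁺`. -/
def primalObjective (Q : X → ℝ) (W : X → Y → ℝ) (R : ℝ) (P P' : X × Y → ℝ) : EReal :=
  relEntropy P (jointDist Q W) +
    max 0 (relEntropy P' (prodDist Q (marginalY P)) - (R : EReal))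

/-- The primal cost-constrained exponent, as an iterated infimum in `EReal`. -/
def Ercost (Q : X → ℝ) (W : X → Y → ℝ) (q : X → Y → ℝ) (R : ℝ) (a : Fin L → X → ℝ) : EReal :=
  ⨅ P ∈ setS Y Q a, ⨅ P' ∈ setT Q q a P, primalObjective Q W R P P'

/-- The exponential tilt `exp (∑ l, r_l (a_l(x) - φ_l))`. -/
def tilt (Q : X → ℝ) (a : Fin L → X → ℝ) (r : Fin L → ℝ) (x : X) : ℝ :=
  Real.exp (∑ l, r l * (a l x - costMean Q a l))

/-- `E[q(X',Y)^s exp (∑ l, r'_l (a_l(X') - φ_l)) | Y = y]`; as `X' ~ Q` is independent of `Y`,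
this is the sum against `Q`. Here `0 ^ 0 = 1`. -/
def condTerm (Q : X → ℝ) (q : X → Y → ℝ) (a : Fin L → X → ℝ) (s : ℝ) (rbar : Fin L → ℝ)
    (y : Y) : ℝ :=
  ∑ x, Q x * (q x y ^ s * tilt Q a rbar x)

open Classical in
/-- The ratio of `E[q(X',Y)^s exp (∑ l, r'_l (a_l(X') - φ_l)) | Y = y]` to
`q(x,y)^s exp (∑ l, r_l (a_l(x) - φ_l))`, equal to `+∞` whenever the denominator vanishes
(also for `0 / 0`). -/
def dualRatio (Q : X → ℝ) (q : X → Y → ℝ) (a : Fin L → X → ℝ) (s : ℝ) (r rbar : Fin L → ℝ)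
    (x : X) (y : Y) : ℝ≥0∞ :=
  if q x y ^ s * tilt Q a r x = 0 then ⊤
  else ENNReal.ofReal (condTerm Q q a s rbar y / (q x y ^ s * tilt Q a r x))

/-- `-log E[(ratio)^ρ]` with `(X, Y) ~ Q(x) W(y|x)`. -/
def dualObjective (Q : X → ℝ) (W : X → Y → ℝ) (q : X → Y → ℝ) (ρ : ℝ) (a : Fin L → X → ℝ)
    (s : ℝ) (r rbar : Fin L → ℝ) : EReal :=
  -ENNReal.log (∑ x, ∑ y, ENNReal.ofReal (Q x * W x y) * dualRatio Q q a s r rbar x y ^ ρ)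

/-- `E_0^cost(Q, ρ, {a_l})`: supremum over `s ≥ 0` and `{r_l}`, `{r'_l}`. -/
def E0cost (Q : X → ℝ) (W : X → Y → ℝ) (q : X → Y → ℝ) (ρ : ℝ) (a : Fin L → X → ℝ) : EReal :=
  ⨆ (s : ℝ) (_ : 0 ≤ s) (r : Fin L → ℝ) (rbar : Fin L → ℝ), dualObjective Q W q ρ a s r rbar

end CostExponent

end

/-! Since `[c]^+` is the maximum of `ρ c` over `ρ ∈ [0,1]`, the primal problem is a min-max of
`D(P‖Q×W) + ρ (D(P'‖Q×P_Y) - R)`. This is affine in `ρ` and, because relative entropy is jointly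
convex, convex in `(P, P')`. On a compact convex set of pairs, Sion's theorem gives a saddle point
(`exists_saddlePoint`), hence attainment on both sides.

For fixed `ρ` the remaining minimum is `E0cost`, by Lagrange duality. The multipliers are `s` for
the metric inequality and `r`, `rbar` for the costs of `P` and `P'`. The Lagrangian is minimized
explicitly: over `P'` with given `Y`-marginal by the log-sum inequality on each fibre, which
produces `condTerm`; then over `P` by the Gibbs variational principle, which produces the outer
`-log`. This gives `realDual_le_lagrangian` and, with equality for `s > 0`,
`exists_lagrangian_eq_realDual`. Multipliers that nearly close the gap come from a second use of
Sion's theorem, `exists_multipliers`.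

Infinite values are removed beforehand. If `q > 0` on the support of `Q×W`, a finite objective
confines `P` and `P'` to supports where every logarithm is finite. If `q` vanishes somewhere on that
support, both sides equal `[-R]^+` by direct computation. -/

noncomputable section

namespace CostExponent

open scoped ENNReal

/-! ### Log-sum inequality and joint convexity of `a log (a / b)` -/

section LogSum

/-- The tangent inequality for the perspective `(a, b) ↦ a log (a / b)`. -/
lemma mul_log_sub_mul_log_ge {a b c d : ℝ} (ha : 0 ≤ a) (hb : 0 ≤ b) (hab : b = 0 → a = 0)
    (hc : 0 < c) (hd : 0 < d) :
    a * Real.log c - a * Real.log d + a - b * (c / d) ≤ a * Real.log a - a * Real.log b := by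
  rcases ha.eq_or_lt with rfl | ha
  · have : 0 ≤ b * (c / d) := by positivity
    simpa using this
  have hb : 0 < b := hb.lt_of_ne fun h => ha.ne' (hab h.symm)
  -- The argument is `1` exactly when `a / b = c / d`, the point of tangency.
  have h := Real.log_le_sub_one_of_pos (show 0 < b * c / (a * d) by positivity)
  rw [Real.log_div (by positivity) (by positivity), Real.log_mul hb.ne' hc.ne',
    Real.log_mul ha.ne' hd.ne'] at h
  have h2 := mul_le_mul_of_nonneg_left h ha.le
  have h3 : a * (b * c / (a * d) - 1) = b * (c / d) - a := by field_simp
  linarith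

/-- The log-sum inequality. -/
lemma log_sum_le {ι : Type*} [Fintype ι] {p w : ι → ℝ} (hp : ∀ i, 0 ≤ p i) (hw : ∀ i, 0 ≤ w i)
    (hpw : ∀ i, w i = 0 → p i = 0) :
    (∑ i, p i) * Real.log (∑ i, p i) - (∑ i, p i) * Real.log (∑ i, w i) ≤
      ∑ i, (p i * Real.log (p i) - p i * Real.log (w i)) := by
  rcases (Finset.sum_nonneg fun i _ => hp i : 0 ≤ ∑ i, p i).eq_or_lt with h0 | hc
  · have h : ∀ i, p i = 0 := fun i =>
      (Finset.sum_eq_zero_iff_of_nonneg fun i _ => hp i).1 h0.symm i (Finset.mem_univ i)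
    simp [h]
  have hd : 0 < ∑ i, w i := by
    refine (Finset.sum_nonneg fun i _ => hw i).lt_of_ne fun h => hc.ne' ?_
    have h : ∀ i, w i = 0 := fun i =>
      (Finset.sum_eq_zero_iff_of_nonneg fun i _ => hw i).1 h.symm i (Finset.mem_univ i)
    exact Finset.sum_eq_zero fun i _ => hpw i (h i)
  -- The tangents are taken at the totals `c = ∑ p`, `d = ∑ w`, so that the correction terms `∑ p -
  -- (∑ w) (c / d)` cancel.
  have h := Finset.sum_le_sum fun i (_ : i ∈ Finset.univ) =>
    mul_log_sub_mul_log_ge (hp i) (hw i) (hpw i) hc hd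
  refine le_trans (le_of_eq ?_) h
  rw [Finset.sum_sub_distrib, Finset.sum_add_distrib, Finset.sum_sub_distrib, ← Finset.sum_mul,
    ← Finset.sum_mul, ← Finset.sum_mul, mul_div_cancel₀ _ hd.ne']
  ring

/-- Joint convexity of `(a, b) ↦ a log (a / b)`. -/
lemma perspective_convex {a₁ b₁ a₂ b₂ s t : ℝ} (ha₁ : 0 ≤ a₁) (hb₁ : 0 ≤ b₁) (ha₂ : 0 ≤ a₂)
    (hb₂ : 0 ≤ b₂) (h₁ : b₁ = 0 → a₁ = 0) (h₂ : b₂ = 0 → a₂ = 0) (hs : 0 ≤ s) (ht : 0 ≤ t) :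
    (s * a₁ + t * a₂) * Real.log (s * a₁ + t * a₂)
        - (s * a₁ + t * a₂) * Real.log (s * b₁ + t * b₂) ≤
      s * (a₁ * Real.log a₁ - a₁ * Real.log b₁) + t * (a₂ * Real.log a₂ - a₂ * Real.log b₂) := by
  have hsa : 0 ≤ s * a₁ := by positivity
  have hta : 0 ≤ t * a₂ := by positivity
  have hsb : 0 ≤ s * b₁ := by positivity
  have htb : 0 ≤ t * b₂ := by positivity
  rcases (add_nonneg hsa hta).eq_or_lt with h0 | hc
  · have e1 : s * a₁ = 0 := by linarith
    have e2 : t * a₂ = 0 := by linarith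
    rw [mul_sub, mul_sub, ← mul_assoc, ← mul_assoc, ← mul_assoc, ← mul_assoc, e1, e2]
    simp
  have hd : 0 < s * b₁ + t * b₂ := by
    refine (add_nonneg hsb htb).lt_of_ne fun h => hc.ne' ?_
    have e1 : s * b₁ = 0 := by linarith
    have e2 : t * b₂ = 0 := by linarith
    have e3 : s * a₁ = 0 := by
      rcases mul_eq_zero.1 e1 with h | h <;> simp [h, h₁]
    have e4 : t * a₂ = 0 := by
      rcases mul_eq_zero.1 e2 with h | h <;> simp [h, h₂]
    rw [e3, e4, add_zero]
  have g1 := mul_le_mul_of_nonneg_left (mul_log_sub_mul_log_ge ha₁ hb₁ h₁ hc hd) hs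
  have g2 := mul_le_mul_of_nonneg_left (mul_log_sub_mul_log_ge ha₂ hb₂ h₂ hc hd) ht
  refine le_trans (le_of_eq ?_) (add_le_add g1 g2)
  field_simp
  ring

end LogSum

/-! ### Lagrange multipliers from Sion's minimax theorem -/

section Multipliers

/-- Lagrange multipliers for a convex function on a compact convex set subject to one linear
inequality and finitely many linear equalities: every number below the constrained infimum is a
lower bound of the Lagrangian for suitable multipliers, the one of the inequality being positive. -/
lemma exists_multipliers {E ι : Type*} [Fintype ι] [TopologicalSpace E] [AddCommGroup E]
    [Module ℝ E] [IsTopologicalAddGroup E] [ContinuousSMul ℝ E] {K : Set E} (hne : K.Nonempty)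
    (hc : Convex ℝ K) (hK : IsCompact K) {F : E → ℝ} (hF : ConvexOn ℝ K F)
    (hFc : ContinuousOn F K) (G : E →L[ℝ] ℝ) (H : ι → E →L[ℝ] ℝ) {m : ℝ}
    (hm : ∀ z ∈ K, 0 ≤ G z → (∀ i, H i z = 0) → m ≤ F z) {m' : ℝ} (hm' : m' < m) :
    ∃ s : ℝ, 0 < s ∧ ∃ t : ι → ℝ, ∀ z ∈ K, m' ≤ F z - s * G z + ∑ i, t i * H i z := by
  let Φ : E → ℝ × (ι → ℝ) → ℝ := fun z y => F z - y.1 * G z + ∑ i, y.2 i * H i z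
  -- Compactness of `K` suffices for the minimax theorem, so the multiplier set may be unbounded and
  -- open. Strict positivity is what later keeps `P'` off the zeros of `q`.
  let S : Set (ℝ × (ι → ℝ)) := {y | 0 < y.1}
  have hmm := Sion.minimax' (f := fun z y => (Φ z y : EReal)) (X := K) (Y := S) hne hc hK
    (fun y _ => by
      refine (continuous_coe_real_ereal.comp_continuousOn ?_).lowerSemicontinuousOn
      exact (hFc.sub (by fun_prop)).add (by fun_prop))
    (fun y _ => by
      have : ConvexOn ℝ K fun z => Φ z y := by
        refine ⟨hc, fun z₁ h₁ z₂ h₂ s t hs ht hst => ?_⟩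
        have h := hF.2 h₁ h₂ hs ht hst
        simp only [Φ, map_add, map_smul, smul_eq_mul] at h ⊢
        have e : ∑ i, y.2 i * (s * H i z₁ + t * H i z₂)
            = s * ∑ i, y.2 i * H i z₁ + t * ∑ i, y.2 i * H i z₂ := by
          rw [Finset.mul_sum, Finset.mul_sum, ← Finset.sum_add_distrib]
          exact Finset.sum_congr rfl fun i _ => by ring
        rw [e]
        linarith
      exact this.quasiconvexOn.monotone_comp (g := fun x : ℝ => (x : EReal))
        EReal.coe_strictMono.monotone)
    (by
      intro y₁ h₁ y₂ h₂ s t hs ht hst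
      simp only [S, Set.mem_ofPred_eq] at h₁ h₂ ⊢
      exact convex_Ioi (0 : ℝ) h₁ h₂ hs ht hst)
    (fun z _ => by
      refine (continuous_coe_real_ereal.comp_continuousOn ?_).upperSemicontinuousOn
      fun_prop)
    (fun z _ => by
      have : ConcaveOn ℝ S fun y => Φ z y := by
        refine ⟨?_, fun y₁ h₁ y₂ h₂ s t hs ht hst => ?_⟩
        · intro y₁ h₁ y₂ h₂ s t hs ht hst
          exact convex_Ioi (0 : ℝ) h₁ h₂ hs ht hst
        simp only [Φ, Prod.fst_add, Prod.snd_add, Prod.smul_fst, Prod.smul_snd, Pi.add_apply,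
          Pi.smul_apply, smul_eq_mul]
        have e : ∑ i, (s * y₁.2 i + t * y₂.2 i) * H i z
            = s * ∑ i, y₁.2 i * H i z + t * ∑ i, y₂.2 i * H i z := by
          rw [Finset.mul_sum, Finset.mul_sum, ← Finset.sum_add_distrib]
          exact Finset.sum_congr rfl fun i _ => by ring
        rw [e]
        have e2 : F z = s * F z + t * F z := by rw [← add_mul, hst, one_mul]
        linarith
      exact this.quasiconcaveOn.monotone_comp (g := fun x : ℝ => (x : EReal))
        EReal.coe_strictMono.monotone)
  -- At a feasible point a small multiplier costs at most `m - c`; at an infeasible point the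
  -- multiplier of a violated constraint lifts the Lagrangian to at least `c`.
  have hle : (m : EReal) ≤ ⨅ z ∈ K, ⨆ y ∈ S, (Φ z y : EReal) := by
    refine le_iInf₂ fun z hz => ?_
    refine EReal.ge_of_forall_gt_iff_ge.1 fun c hcm => ?_
    have hcm : c < m := EReal.coe_lt_coe_iff.1 hcm
    suffices h : ∃ y ∈ S, c ≤ Φ z y by
      obtain ⟨y, hy, h⟩ := h
      exact (EReal.coe_le_coe_iff.2 h).trans
        (le_iSup₂ (f := fun (y : ℝ × (ι → ℝ)) (_ : y ∈ S) => (Φ z y : EReal)) y hy)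
    by_cases hH : ∀ i, H i z = 0
    · rcases le_or_gt 0 (G z) with hG | hG
      -- The `+ 1` covers `G z = 0` and still leaves `s * G z ≤ m - c`.
      · refine ⟨((m - c) / (G z + 1), 0), show 0 < (m - c) / (G z + 1) from div_pos (by linarith) (by linarith), ?_⟩
        have h1 : (m - c) / (G z + 1) * G z ≤ m - c := by
          rw [div_mul_eq_mul_div, div_le_iff₀ (by linarith)]
          nlinarith
        have h2 := hm z hz hG hH
        simp only [Φ, Pi.zero_apply, zero_mul, Finset.sum_const_zero, add_zero]
        linarith
      · refine ⟨(1 + |c - F z| / -G z, 0),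
          show 0 < 1 + |c - F z| / -G z from
            add_pos_of_pos_of_nonneg one_pos (div_nonneg (abs_nonneg _) (by linarith)), ?_⟩
        have h1 : (1 + |c - F z| / -G z) * G z = G z - |c - F z| := by
          have := hG.ne
          field_simp
          ring
        have h2 := le_abs_self (c - F z)
        simp only [Φ, Pi.zero_apply, zero_mul, Finset.sum_const_zero, add_zero, h1]
        linarith
    · classical
      obtain ⟨i, hi⟩ := not_forall.1 hH
      -- The entry solves `F z - G z + t * H i z = c`.
      refine ⟨(1, Pi.single i ((c - F z + G z) / H i z)), (one_pos : (0 : ℝ) < 1), ?_⟩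
      have h1 : ∑ j, (Pi.single i ((c - F z + G z) / H i z) : ι → ℝ) j * H j z
          = c - F z + G z := by
        rw [Finset.sum_eq_single i (fun j _ hj => by simp [hj]) (by simp)]
        simp [div_mul_cancel₀ _ hi]
      simp only [Φ, h1]
      linarith
  rw [hmm] at hle
  -- The supremum over multipliers need not be attained, which is why `m' < m` is needed.
  have hlt := (EReal.coe_lt_coe_iff.2 hm').trans_le hle
  obtain ⟨y, hy⟩ := lt_iSup_iff.1 hlt
  obtain ⟨hyS, hy⟩ := lt_iSup_iff.1 hy
  refine ⟨y.1, hyS, y.2, fun z hz => ?_⟩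
  exact EReal.coe_le_coe_iff.1 (hy.le.trans (iInf₂_le z hz))

end Multipliers


/-! ### Real-valued relative entropy and the Gibbs variational principle -/

section RealDivergence

variable {α : Type*} [Fintype α]

/-- The relative entropy as a real number, meaningful when `P` is absolutely continuous with
respect to `N`. -/
def realDiv (N P : α → ℝ) : ℝ := ∑ z, (P z * Real.log (P z) - P z * Real.log (N z))

lemma relEntropy_eq_realDiv {N P : α → ℝ} (h : ∀ z, N z = 0 → P z = 0) :
    relEntropy P N = (realDiv N P : EReal) := by
  rw [relEntropy, if_pos h, realDiv]
  congr 1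
  refine Finset.sum_congr rfl fun z _ => ?_
  by_cases hP : P z = 0
  · simp [hP]
  · rw [Real.log_div hP fun hN => hP (h z hN), mul_sub]

lemma realDiv_self (N : α → ℝ) : realDiv N N = 0 := by simp [realDiv]

/-- With the two logarithms kept apart, one summand is `t log t`, continuous at `0`, and the other
is linear in `P`. -/
lemma continuous_realDiv (N : α → ℝ) : Continuous (realDiv N) := by
  unfold realDiv
  have h : ∀ z : α, Continuous fun P : α → ℝ => P z * Real.log (P z) := fun z =>
    Real.continuous_mul_log.comp (continuous_apply z)
  fun_prop

lemma realDiv_convex {N P₁ P₂ : α → ℝ} (hN : ∀ z, 0 ≤ N z) (h₁ : ∀ z, 0 ≤ P₁ z)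
    (h₂ : ∀ z, 0 ≤ P₂ z) (hN₁ : ∀ z, N z = 0 → P₁ z = 0) (hN₂ : ∀ z, N z = 0 → P₂ z = 0)
    {s t : ℝ} (hs : 0 ≤ s) (ht : 0 ≤ t) (hst : s + t = 1) :
    realDiv N (s • P₁ + t • P₂) ≤ s * realDiv N P₁ + t * realDiv N P₂ := by
  simp only [realDiv, Finset.mul_sum, ← Finset.sum_add_distrib]
  refine Finset.sum_le_sum fun z _ => ?_
  have h := perspective_convex (h₁ z) (hN z) (h₂ z) (hN z) (hN₁ z) (hN₂ z) hs ht
  rw [← add_mul, hst, one_mul] at h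
  exact h

/-- The Gibbs variational inequality. -/
lemma neg_log_sum_exp_le {N P h : α → ℝ} (hN : ∀ z, 0 ≤ N z) (hP : P ∈ stdSimplex ℝ α)
    (hNP : ∀ z, N z = 0 → P z = 0) :
    -Real.log (∑ z, N z * Real.exp (h z)) ≤ realDiv N P - ∑ z, P z * h z := by
  have key := log_sum_le (p := P) (w := fun z => N z * Real.exp (h z)) hP.1
    (fun z => mul_nonneg (hN z) (Real.exp_pos _).le)
    (fun z hz => hNP z ((mul_eq_zero.1 hz).resolve_right (Real.exp_pos _).ne'))
  rw [hP.2, Real.log_one, one_mul, one_mul, zero_sub] at key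
  refine key.trans (le_of_eq ?_)
  rw [realDiv, ← Finset.sum_sub_distrib]
  refine Finset.sum_congr rfl fun z _ => ?_
  by_cases hz : N z = 0
  · simp [hNP z hz]
  · rw [Real.log_mul hz (Real.exp_pos _).ne', Real.log_exp]
    ring

/-- The exponentially tilted distribution attains equality in the Gibbs inequality. -/
lemma exists_gibbs {N : α → ℝ} (hN : N ∈ stdSimplex ℝ α) (h : α → ℝ) :
    ∃ P ∈ stdSimplex ℝ α, (∀ z, N z = 0 → P z = 0) ∧
      realDiv N P - ∑ z, P z * h z = -Real.log (∑ z, N z * Real.exp (h z)) := by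
  set Z := ∑ z, N z * Real.exp (h z) with hZ
  have hnn : ∀ z, 0 ≤ N z * Real.exp (h z) := fun z => mul_nonneg (hN.1 z) (Real.exp_pos _).le
  have hZ0 : 0 < Z := by
    refine (Finset.sum_nonneg fun z _ => hnn z).lt_of_ne fun h0 => ?_
    have h1 : ∀ z, N z = 0 := fun z => by
      have := (Finset.sum_eq_zero_iff_of_nonneg fun i _ => hnn i).1 h0.symm z (Finset.mem_univ z)
      exact (mul_eq_zero.1 this).resolve_right (Real.exp_pos _).ne'
    have h2 := hN.2
    simp [h1] at h2
  have hsum : ∑ z, N z * Real.exp (h z) / Z = 1 := by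
    rw [← Finset.sum_div, ← hZ, div_self hZ0.ne']
  refine ⟨fun z => N z * Real.exp (h z) / Z, ⟨fun z => div_nonneg (hnn z) hZ0.le, hsum⟩,
    fun z hz => by simp [hz], ?_⟩
  have e : ∀ z, N z * Real.exp (h z) / Z * Real.log (N z * Real.exp (h z) / Z)
      - N z * Real.exp (h z) / Z * Real.log (N z) - N z * Real.exp (h z) / Z * h z
      = N z * Real.exp (h z) / Z * -Real.log Z := fun z => by
    by_cases hz : N z = 0
    · simp [hz]
    · rw [Real.log_div (mul_ne_zero hz (Real.exp_pos _).ne') hZ0.ne',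
        Real.log_mul hz (Real.exp_pos _).ne', Real.log_exp]
      ring
  rw [realDiv, ← Finset.sum_sub_distrib, Finset.sum_congr rfl fun z _ => e z, ← Finset.sum_mul,
    hsum, one_mul]

lemma expectLog_of_support {P f : α → ℝ} (h : ∀ z, f z = 0 → P z = 0) :
    expectLog P f = ((∑ z, P z * Real.log (f z) : ℝ) : EReal) := if_pos h

lemma realDiv_nonneg {N P : α → ℝ} (hN : N ∈ stdSimplex ℝ α) (hP : P ∈ stdSimplex ℝ α)
    (hNP : ∀ z, N z = 0 → P z = 0) : 0 ≤ realDiv N P := by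
  simpa [hN.2] using neg_log_sum_exp_le (h := 0) hN.1 hP hNP

lemma relEntropy_nonneg {N P : α → ℝ} (hN : N ∈ stdSimplex ℝ α) (hP : P ∈ stdSimplex ℝ α) :
    0 ≤ relEntropy P N := by
  by_cases h : ∀ z, N z = 0 → P z = 0
  · rw [relEntropy_eq_realDiv h]
    exact EReal.coe_nonneg.2 (realDiv_nonneg hN hP h)
  · rw [relEntropy, if_neg h]
    exact le_top

end RealDivergence

/-! ### Divergence from `Q` times the own `Y`-marginal -/

section ConditionalDivergence

variable {X Y : Type*} [Fintype X] [Fintype Y]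

/-- The relative entropy of `P` with respect to the product of `Q` and the `Y`-marginal of `P`, as
a real number. -/
def condDiv (Q : X → ℝ) (P : X × Y → ℝ) : ℝ := realDiv (prodDist Q (marginalY P)) P

omit [Fintype Y] in
lemma marginalY_nonneg {P : X × Y → ℝ} (hP : ∀ z, 0 ≤ P z) (y : Y) : 0 ≤ marginalY P y :=
  Finset.sum_nonneg fun x _ => hP (x, y)

omit [Fintype Y] in
lemma eq_zero_of_marginalY {P : X × Y → ℝ} (hP : ∀ z, 0 ≤ P z) {z : X × Y}
    (h : marginalY P z.2 = 0) : P z = 0 :=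
  (Finset.sum_eq_zero_iff_of_nonneg fun x _ => hP (x, z.2)).1 h z.1 (Finset.mem_univ _)

lemma sum_mul_snd (P : X × Y → ℝ) (k : Y → ℝ) :
    ∑ z, P z * k z.2 = ∑ y, marginalY P y * k y := by
  simp only [Fintype.sum_prod_type_right, marginalY, Finset.sum_mul]

lemma sum_marginalY (P : X × Y → ℝ) : ∑ y, marginalY P y = ∑ z, P z := by
  simp only [Fintype.sum_prod_type_right, marginalY]

omit [Fintype Y] in
lemma marginalY_combo (s t : ℝ) (P₁ P₂ : X × Y → ℝ) (y : Y) :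
    marginalY (s • P₁ + t • P₂) y = s * marginalY P₁ y + t * marginalY P₂ y := by
  simp [marginalY, Finset.sum_add_distrib, Finset.mul_sum]

lemma marginalY_mem {P : X × Y → ℝ} (hP : P ∈ stdSimplex ℝ (X × Y)) :
    marginalY P ∈ stdSimplex ℝ Y :=
  ⟨marginalY_nonneg hP.1, (sum_marginalY P).trans hP.2⟩

lemma prodDist_mem {Q : X → ℝ} {V : Y → ℝ} (hQ : Q ∈ stdSimplex ℝ X) (hV : V ∈ stdSimplex ℝ Y) :
    prodDist Q V ∈ stdSimplex ℝ (X × Y) := by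
  refine ⟨fun z => mul_nonneg (hQ.1 _) (hV.1 _), ?_⟩
  simp [prodDist, Fintype.sum_prod_type, ← Finset.mul_sum, hQ.2, hV.2]

omit [Fintype Y] in
lemma marginalY_prodDist {Q : X → ℝ} (hQ : Q ∈ stdSimplex ℝ X) (V : Y → ℝ) :
    marginalY (prodDist Q V) = V := by
  ext y
  simp [marginalY, prodDist, ← Finset.sum_mul, hQ.2]

lemma jointDist_mem {Q : X → ℝ} {W : X → Y → ℝ} (hQ : Q ∈ stdSimplex ℝ X)
    (hW : ∀ x, W x ∈ stdSimplex ℝ Y) : jointDist Q W ∈ stdSimplex ℝ (X × Y) := by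
  refine ⟨fun z => mul_nonneg (hQ.1 _) ((hW _).1 _), ?_⟩
  have h : ∀ x, ∑ y, W x y = 1 := fun x => (hW x).2
  simp [jointDist, Fintype.sum_prod_type, ← Finset.mul_sum, h, hQ.2]

lemma sum_jointDist_mul_fst {Q : X → ℝ} {W : X → Y → ℝ} (hW : ∀ x, W x ∈ stdSimplex ℝ Y)
    (k : X → ℝ) : ∑ z, jointDist Q W z * k z.1 = ∑ x, Q x * k x := by
  have h : ∀ x, ∑ y, W x y = 1 := fun x => (hW x).2
  simp [jointDist, Fintype.sum_prod_type, ← Finset.mul_sum, ← Finset.sum_mul, h]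

lemma sum_prodDist_mul_fst {Q : X → ℝ} {V : Y → ℝ} (hV : V ∈ stdSimplex ℝ Y)
    (k : X → ℝ) : ∑ z, prodDist Q V z * k z.1 = ∑ x, Q x * k x :=
  sum_jointDist_mul_fst (W := fun _ => V) (fun _ => hV) k

/-- The logarithm of the product splits on the support of `P`. This isolates a linear term from the
negative conditional entropy, the part to which the fibrewise log-sum inequality applies. -/
lemma condDiv_eq {Q : X → ℝ} {P : X × Y → ℝ} (hP : ∀ z, 0 ≤ P z)
    (hQP : ∀ z, Q z.1 = 0 → P z = 0) :
    condDiv Q P = ∑ z, (P z * Real.log (P z) - P z * Real.log (marginalY P z.2))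
      - ∑ z, P z * Real.log (Q z.1) := by
  rw [condDiv, realDiv, ← Finset.sum_sub_distrib]
  refine Finset.sum_congr rfl fun z _ => ?_
  by_cases hz : P z = 0
  · simp [hz]
  · rw [prodDist, Real.log_mul (fun h => hz (hQP z h)) fun h => hz (eq_zero_of_marginalY hP h)]
    ring

/-- The reference measure moves with `P`, but linearly, so joint convexity of the perspective
function is what is needed. -/
lemma condDiv_convex {Q : X → ℝ} {P₁ P₂ : X × Y → ℝ} (hQ : ∀ x, 0 ≤ Q x) (h₁ : ∀ z, 0 ≤ P₁ z)
    (h₂ : ∀ z, 0 ≤ P₂ z) (hQ₁ : ∀ z, Q z.1 = 0 → P₁ z = 0) (hQ₂ : ∀ z, Q z.1 = 0 → P₂ z = 0)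
    {s t : ℝ} (hs : 0 ≤ s) (ht : 0 ≤ t) :
    condDiv Q (s • P₁ + t • P₂) ≤ s * condDiv Q P₁ + t * condDiv Q P₂ := by
  simp only [condDiv, realDiv, Finset.mul_sum, ← Finset.sum_add_distrib]
  refine Finset.sum_le_sum fun z _ => ?_
  have h0 : ∀ P : X × Y → ℝ, (∀ z, 0 ≤ P z) → (∀ z, Q z.1 = 0 → P z = 0) →
      prodDist Q (marginalY P) z = 0 → P z = 0 := fun P hP hQP h =>
    (mul_eq_zero.1 h).elim (hQP z) (eq_zero_of_marginalY hP)
  have h := perspective_convex (h₁ z) (mul_nonneg (hQ z.1) (marginalY_nonneg h₁ z.2))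
    (h₂ z) (mul_nonneg (hQ z.1) (marginalY_nonneg h₂ z.2)) (h0 P₁ h₁ hQ₁) (h0 P₂ h₂ hQ₂) hs ht
  have e : prodDist Q (marginalY (s • P₁ + t • P₂)) z
      = s * (Q z.1 * marginalY P₁ z.2) + t * (Q z.1 * marginalY P₂ z.2) := by
    rw [prodDist, marginalY_combo]
    ring
  rw [e]
  exact h

/-- On this set `condDiv_eq` gives only terms `t log t` in linear functions of `P`, plus a linear
term. -/
lemma continuousOn_condDiv (Q : X → ℝ) :
    ContinuousOn (condDiv (Y := Y) Q) {P | (∀ z, 0 ≤ P z) ∧ ∀ z, Q z.1 = 0 → P z = 0} := by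
  have h1 : ∀ z : X × Y, Continuous fun P : X × Y → ℝ => P z * Real.log (P z) := fun z =>
    Real.continuous_mul_log.comp (continuous_apply z)
  have h2 : ∀ y : Y, Continuous fun P : X × Y → ℝ => marginalY P y * Real.log (marginalY P y) :=
    fun y => Real.continuous_mul_log.comp (by unfold marginalY; fun_prop)
  have h : Continuous fun P : X × Y → ℝ => ∑ z, P z * Real.log (P z)
      - ∑ y, marginalY P y * Real.log (marginalY P y) - ∑ z, P z * Real.log (Q z.1) := by
    fun_prop
  refine h.continuousOn.congr fun P hP => ?_
  rw [condDiv_eq hP.1 hP.2, Finset.sum_sub_distrib,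
    sum_mul_snd P fun y => Real.log (marginalY P y)]

/-- The common marginal makes the second divergence a function of `P'` alone, which decouples the
two convexity arguments. -/
lemma relEntropy_eq_condDiv {Q : X → ℝ} {P P' : X × Y → ℝ} (hP : ∀ z, 0 ≤ P' z)
    (hQP : ∀ z, Q z.1 = 0 → P' z = 0) (hm : marginalY P' = marginalY P) :
    relEntropy P' (prodDist Q (marginalY P)) = (condDiv Q P' : EReal) := by
  rw [← hm, condDiv]
  exact relEntropy_eq_realDiv fun z hz => (mul_eq_zero.1 hz).elim (hQP z) (eq_zero_of_marginalY hP)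

/-- The log-sum inequality, applied for each `y`. -/
lemma neg_sum_log_le_cond {P w : X × Y → ℝ} (hP : ∀ z, 0 ≤ P z) (hw : ∀ z, 0 ≤ w z)
    (hwP : ∀ z, w z = 0 → P z = 0) :
    -∑ y, marginalY P y * Real.log (∑ x, w (x, y)) ≤
      ∑ z, (P z * Real.log (P z) - P z * Real.log (marginalY P z.2))
        - ∑ z, P z * Real.log (w z) := by
  rw [Finset.sum_sub_distrib, sum_mul_snd P fun y => Real.log (marginalY P y)]
  have h := Finset.sum_le_sum fun y (_ : y ∈ Finset.univ) =>
    log_sum_le (p := fun x => P (x, y)) (w := fun x => w (x, y)) (fun x => hP _) (fun x => hw _)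
      (fun x => hwP _)
  rw [Finset.sum_sub_distrib, ← Fintype.sum_prod_type_right
    (f := fun z => P z * Real.log (P z) - P z * Real.log (w z)), Finset.sum_sub_distrib] at h
  simp only [marginalY]
  linarith

/-- For a prescribed `Y`-marginal `V`, normalizing `w` on each fibre attains equality. -/
lemma exists_cond_eq {w : X × Y → ℝ} {V : Y → ℝ} (hV : ∀ y, 0 ≤ V y) (hw : ∀ z, 0 ≤ w z)
    (hwV : ∀ y, ∑ x, w (x, y) = 0 → V y = 0) :
    ∃ P : X × Y → ℝ, (∀ z, 0 ≤ P z) ∧ (∀ z, w z = 0 → P z = 0) ∧ marginalY P = V ∧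
      ∑ z, (P z * Real.log (P z) - P z * Real.log (marginalY P z.2))
        - ∑ z, P z * Real.log (w z) = -∑ y, V y * Real.log (∑ x, w (x, y)) := by
  -- On a fibre where `w` sums to zero the quotient is `0` by convention, which is harmless because
  -- `V` vanishes there.
  have hm : marginalY (fun z : X × Y => V z.2 * (w z / ∑ x, w (x, z.2))) = V := by
    ext y
    simp only [marginalY, ← Finset.mul_sum, ← Finset.sum_div]
    by_cases hy : ∑ x, w (x, y) = 0
    · simp [hwV y hy]
    · rw [div_self hy, mul_one]
  refine ⟨fun z => V z.2 * (w z / ∑ x, w (x, z.2)), fun z => mul_nonneg (hV _)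
    (div_nonneg (hw z) (Finset.sum_nonneg fun x _ => hw _)), fun z hz => by simp [hz], hm, ?_⟩
  rw [hm, ← Finset.sum_sub_distrib]
  have e := sum_mul_snd (fun z : X × Y => V z.2 * (w z / ∑ x, w (x, z.2)))
    fun y => -Real.log (∑ x, w (x, y))
  rw [hm] at e
  simp only [mul_neg, Finset.sum_neg_distrib] at e
  rw [← e, ← Finset.sum_neg_distrib]
  refine Finset.sum_congr rfl fun z _ => ?_
  by_cases hVz : V z.2 = 0
  · simp [hVz]
  by_cases hwz : w z = 0
  · simp [hwz]
  have hs : ∑ x, w (x, z.2) ≠ 0 := fun h => hVz (hwV _ h)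
  rw [Real.log_mul hVz (div_ne_zero hwz hs), Real.log_div hwz hs]
  ring

end ConditionalDivergence


/-! ### The dual objective as the minimum of a Lagrangian -/

section Dual

variable {X Y : Type*} [Fintype X] [Fintype Y] {L : ℕ}

/-- The exponent of `tilt`. -/
def logTilt (Q : X → ℝ) (a : Fin L → X → ℝ) (r : Fin L → ℝ) (x : X) : ℝ :=
  ∑ l, r l * (a l x - costMean Q a l)

lemma tilt_eq_exp (Q : X → ℝ) (a : Fin L → X → ℝ) (r : Fin L → ℝ) (x : X) :
    tilt Q a r x = Real.exp (logTilt Q a r x) := rfl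

/-- The weight whose sum over `x` is `condTerm`. -/
def weight (Q : X → ℝ) (q : X → Y → ℝ) (a : Fin L → X → ℝ) (s : ℝ) (rbar : Fin L → ℝ)
    (z : X × Y) : ℝ :=
  Q z.1 * (q z.1 z.2 ^ s * tilt Q a rbar z.1)

/-- The logarithm of the `ρ`-th power of `dualRatio`. -/
def dualLogRatio (Q : X → ℝ) (q : X → Y → ℝ) (ρ : ℝ) (a : Fin L → X → ℝ) (s : ℝ)
    (r rbar : Fin L → ℝ) (z : X × Y) : ℝ :=
  ρ * (Real.log (condTerm Q q a s rbar z.2) -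
    (s * Real.log (q z.1 z.2) + logTilt Q a r z.1))

/-- The value of `dualObjective` as a real number. -/
def realDual (Q : X → ℝ) (W : X → Y → ℝ) (q : X → Y → ℝ) (ρ : ℝ) (a : Fin L → X → ℝ)
    (s : ℝ) (r rbar : Fin L → ℝ) : ℝ :=
  -Real.log (∑ z, jointDist Q W z * Real.exp (dualLogRatio Q q ρ a s r rbar z))

/-- The Lagrangian of the primal problem at a fixed `ρ`. -/
def lagrangian (Q : X → ℝ) (W : X → Y → ℝ) (q : X → Y → ℝ) (ρ : ℝ) (a : Fin L → X → ℝ)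
    (s : ℝ) (r rbar : Fin L → ℝ) (P P' : X × Y → ℝ) : ℝ :=
  realDiv (jointDist Q W) P + ρ * (condDiv Q P' -
    s * (∑ z, P' z * Real.log (q z.1 z.2) - ∑ z, P z * Real.log (q z.1 z.2)) +
    ∑ z, P z * logTilt Q a r z.1 - ∑ z, P' z * logTilt Q a rbar z.1)

/-- The alternative `s = 0 ∨ 0 < x` reflects `0 ^ 0 = 1`: for `s = 0` both sides vanish even at `x =
0`. It is the finiteness condition used throughout this part. -/
lemma log_rpow_of_eq_zero_or_pos {x s : ℝ} (h : s = 0 ∨ 0 < x) :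
    Real.log (x ^ s) = s * Real.log x := by
  rcases h with rfl | h
  · simp
  · exact Real.log_rpow h s

lemma rpow_pos_of_eq_zero_or_pos {x s : ℝ} (h : s = 0 ∨ 0 < x) : 0 < x ^ s := by
  rcases h with rfl | h
  · simp
  · exact Real.rpow_pos_of_pos h s

variable {Q : X → ℝ} (hQ : ∀ x, 0 ≤ Q x) {q : X → Y → ℝ} (hq : ∀ x y, 0 ≤ q x y)
  {a : Fin L → X → ℝ} {W : X → Y → ℝ}

omit [Fintype Y] in
include hQ hq in
lemma weight_nonneg (s : ℝ) (rbar : Fin L → ℝ) (z : X × Y) : 0 ≤ weight Q q a s rbar z :=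
  mul_nonneg (hQ _) (mul_nonneg (Real.rpow_nonneg (hq _ _) _) (Real.exp_pos _).le)

omit [Fintype Y] in
include hq in
lemma weight_eq_zero {s : ℝ} {rbar : Fin L → ℝ} {z : X × Y} (h : weight Q q a s rbar z = 0) :
    Q z.1 = 0 ∨ (q z.1 z.2 = 0 ∧ s ≠ 0) := by
  rcases mul_eq_zero.1 h with h | h
  · exact Or.inl h
  · exact Or.inr ((Real.rpow_eq_zero_iff_of_nonneg (hq _ _)).1
      ((mul_eq_zero.1 h).resolve_right (Real.exp_pos _).ne'))

omit [Fintype Y] in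
include hQ hq in
lemma condTerm_pos {s : ℝ} {rbar : Fin L → ℝ} {x : X} {y : Y} (h : Q x ≠ 0)
    (hs : s = 0 ∨ 0 < q x y) : 0 < condTerm Q q a s rbar y := by
  have h1 : 0 < weight Q q a s rbar (x, y) :=
    mul_pos ((hQ x).lt_of_ne h.symm) (mul_pos (rpow_pos_of_eq_zero_or_pos hs) (Real.exp_pos _))
  exact h1.trans_le (Finset.single_le_sum (f := fun x => weight Q q a s rbar (x, y))
    (fun x _ => weight_nonneg hQ hq s rbar (x, y)) (Finset.mem_univ x))

include hQ hq in
-- The support hypothesis excludes an infinite ratio wherever `Q×W` has mass; elsewhere the zero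
-- weight annihilates the term, whatever the ratio.
lemma dualObjective_eq_realDual (hN : jointDist Q W ∈ stdSimplex ℝ (X × Y)) (ρ : ℝ) {s : ℝ}
    (r rbar : Fin L → ℝ) (hs : ∀ z, jointDist Q W z ≠ 0 → s = 0 ∨ 0 < q z.1 z.2) :
    dualObjective Q W q ρ a s r rbar = (realDual Q W q ρ a s r rbar : EReal) := by
  have hterm : ∀ z : X × Y, ENNReal.ofReal (Q z.1 * W z.1 z.2) *
      dualRatio Q q a s r rbar z.1 z.2 ^ ρ =
      ENNReal.ofReal (jointDist Q W z * Real.exp (dualLogRatio Q q ρ a s r rbar z)) := by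
    intro z
    by_cases hz : jointDist Q W z = 0
    · have hz' : Q z.1 * W z.1 z.2 = 0 := hz
      simp [hz, hz']
    have hsz := hs z hz
    have hc : 0 < condTerm Q q a s rbar z.2 := condTerm_pos hQ hq (left_ne_zero_of_mul hz) hsz
    have hd : 0 < q z.1 z.2 ^ s * tilt Q a r z.1 :=
      mul_pos (rpow_pos_of_eq_zero_or_pos hsz) (Real.exp_pos _)
    rw [dualRatio, if_neg hd.ne', ENNReal.ofReal_rpow_of_pos (div_pos hc hd),
      ENNReal.ofReal_mul (hN.1 z)]
    congr 2
    rw [Real.rpow_def_of_pos (div_pos hc hd), Real.log_div hc.ne' hd.ne', tilt_eq_exp,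
      Real.log_mul (rpow_pos_of_eq_zero_or_pos hsz).ne' (Real.exp_pos _).ne',
      log_rpow_of_eq_zero_or_pos hsz, Real.log_exp, dualLogRatio, mul_comm]
  have hnn : ∀ z, 0 ≤ jointDist Q W z * Real.exp (dualLogRatio Q q ρ a s r rbar z) := fun z =>
    mul_nonneg (hN.1 z) (Real.exp_pos _).le
  have hpos : 0 < ∑ z, jointDist Q W z * Real.exp (dualLogRatio Q q ρ a s r rbar z) := by
    refine (Finset.sum_nonneg fun z _ => hnn z).lt_of_ne fun h0 => ?_
    have h1 : ∀ z, jointDist Q W z = 0 := fun z => by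
      have := (Finset.sum_eq_zero_iff_of_nonneg fun i _ => hnn i).1 h0.symm z (Finset.mem_univ z)
      exact (mul_eq_zero.1 this).resolve_right (Real.exp_pos _).ne'
    have h2 := hN.2
    simp [h1] at h2
  rw [dualObjective, ← Fintype.sum_prod_type
    (f := fun z => ENNReal.ofReal (Q z.1 * W z.1 z.2) * dualRatio Q q a s r rbar z.1 z.2 ^ ρ),
    Finset.sum_congr rfl fun z _ => hterm z, ← ENNReal.ofReal_sum_of_nonneg fun z _ => hnn z,
    ENNReal.log_ofReal_of_pos hpos, realDual, EReal.coe_neg]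

lemma sum_mul_dualLogRatio (ρ s : ℝ) (r rbar : Fin L → ℝ) (P : X × Y → ℝ) :
    ∑ z, P z * dualLogRatio Q q ρ a s r rbar z =
      ρ * (∑ y, marginalY P y * Real.log (condTerm Q q a s rbar y)
        - s * ∑ z, P z * Real.log (q z.1 z.2) - ∑ z, P z * logTilt Q a r z.1) := by
  rw [← sum_mul_snd P fun y => Real.log (condTerm Q q a s rbar y), Finset.mul_sum,
    ← Finset.sum_sub_distrib, ← Finset.sum_sub_distrib, Finset.mul_sum]
  refine Finset.sum_congr rfl fun z _ => ?_
  rw [dualLogRatio]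
  ring

lemma sum_mul_log_weight {s : ℝ} {P : X × Y → ℝ} (rbar : Fin L → ℝ)
    (hQP : ∀ z, Q z.1 = 0 → P z = 0) (hqP : ∀ z, P z ≠ 0 → s = 0 ∨ 0 < q z.1 z.2) :
    ∑ z, P z * Real.log (weight Q q a s rbar z) = ∑ z, P z * Real.log (Q z.1) +
      s * ∑ z, P z * Real.log (q z.1 z.2) + ∑ z, P z * logTilt Q a rbar z.1 := by
  rw [Finset.mul_sum, ← Finset.sum_add_distrib, ← Finset.sum_add_distrib]
  refine Finset.sum_congr rfl fun z _ => ?_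
  by_cases hz : P z = 0
  · simp [hz]
  have hpos := rpow_pos_of_eq_zero_or_pos (hqP z hz)
  have ht : tilt Q a rbar z.1 ≠ 0 := (Real.exp_pos _).ne'
  rw [weight, Real.log_mul (fun h => hz (hQP z h)) (mul_ne_zero hpos.ne' ht),
    Real.log_mul hpos.ne' ht, log_rpow_of_eq_zero_or_pos (hqP z hz), tilt_eq_exp, Real.log_exp]
  ring

include hQ hq in
/-- Weak duality. -/
lemma realDual_le_lagrangian (hN : jointDist Q W ∈ stdSimplex ℝ (X × Y)) {ρ : ℝ} (hρ : 0 ≤ ρ)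
    {s : ℝ} (r rbar : Fin L → ℝ) {P P' : X × Y → ℝ} (hP : P ∈ stdSimplex ℝ (X × Y))
    (hNP : ∀ z, jointDist Q W z = 0 → P z = 0) (hP' : ∀ z, 0 ≤ P' z)
    (hQP : ∀ z, Q z.1 = 0 → P' z = 0) (hqP : ∀ z, P' z ≠ 0 → s = 0 ∨ 0 < q z.1 z.2)
    (hm : marginalY P' = marginalY P) :
    realDual Q W q ρ a s r rbar ≤ lagrangian Q W q ρ a s r rbar P P' := by
  -- Gibbs for `P` and fibrewise log-sum for `P'` each produce the mean of `log condTerm`, with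
  -- opposite signs; they cancel because the marginals agree.
  have h1 := neg_log_sum_exp_le (h := dualLogRatio Q q ρ a s r rbar) hN.1 hP hNP
  have h2 := neg_sum_log_le_cond (w := weight Q q a s rbar) hP' (weight_nonneg hQ hq s rbar)
    fun z hz => (weight_eq_zero hq hz).elim (hQP z) fun h => by
      by_contra hPz
      exact (hqP z hPz).elim h.2 fun h' => h'.ne' h.1
  rw [sum_mul_dualLogRatio] at h1
  rw [sum_mul_log_weight rbar hQP hqP, hm] at h2
  have h3 := mul_le_mul_of_nonneg_left h2 hρ
  refine h1.trans ?_
  rw [lagrangian, condDiv_eq hP' hQP, hm]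
  have e : ∀ y, ∑ x, weight Q q a s rbar (x, y) = condTerm Q q a s rbar y := fun y => rfl
  simp only [e] at h3
  linarith

include hQ hq in
/-- For positive `s`, the dual objective is attained by the Lagrangian. -/
lemma exists_lagrangian_eq_realDual (hN : jointDist Q W ∈ stdSimplex ℝ (X × Y)) (ρ : ℝ)
    {s : ℝ} (hs : 0 < s) (r rbar : Fin L → ℝ)
    (hNq : ∀ z, jointDist Q W z ≠ 0 → 0 < q z.1 z.2) :
    ∃ P ∈ stdSimplex ℝ (X × Y), ∃ P' ∈ stdSimplex ℝ (X × Y),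
      (∀ z, jointDist Q W z = 0 → P z = 0) ∧ (∀ z, Q z.1 = 0 → P' z = 0) ∧
      (∀ z, q z.1 z.2 = 0 → P' z = 0) ∧ marginalY P' = marginalY P ∧
      lagrangian Q W q ρ a s r rbar P P' = realDual Q W q ρ a s r rbar := by
  -- First `P` is the equality case of Gibbs; then `P'` is the equality case of log-sum over the
  -- marginal of that `P`.
  obtain ⟨P, hP, hNP, h1⟩ := exists_gibbs hN (dualLogRatio Q q ρ a s r rbar)
  obtain ⟨P', hP', hwP, hm, h2⟩ := exists_cond_eq (w := weight Q q a s rbar)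
    (marginalY_nonneg hP.1) (weight_nonneg hQ hq s rbar) fun y hy => by
      refine Finset.sum_eq_zero fun x _ => hNP (x, y) ?_
      by_contra hz
      exact (condTerm_pos (a := a) (rbar := rbar) hQ hq (left_ne_zero_of_mul hz)
        (Or.inr (hNq _ hz))).ne' hy
  have hQP : ∀ z, Q z.1 = 0 → P' z = 0 := fun z hz => hwP z (by simp [weight, hz])
  -- Here `s ≠ 0` is essential: for `s = 0` the weight would not vanish with `q`.
  have hqP : ∀ z, q z.1 z.2 = 0 → P' z = 0 := fun z hz =>
    hwP z (by simp [weight, hz, Real.zero_rpow hs.ne'])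
  refine ⟨P, hP, P', ⟨hP', ?_⟩, hNP, hQP, hqP, hm, ?_⟩
  · rw [← sum_marginalY, hm, sum_marginalY, hP.2]
  rw [sum_mul_log_weight rbar hQP fun z hz => Or.inr ((hq _ _).lt_of_ne fun h => hz (hqP z h.symm))]
    at h2
  rw [sum_mul_dualLogRatio] at h1
  have e : ∀ y, ∑ x, weight Q q a s rbar (x, y) = condTerm Q q a s rbar y := fun y => rfl
  simp only [e] at h2
  have h3 : condDiv Q P' = -∑ y, marginalY P y * Real.log (condTerm Q q a s rbar y)
      + s * ∑ z, P' z * Real.log (q z.1 z.2) + ∑ z, P' z * logTilt Q a rbar z.1 := by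
    rw [condDiv_eq hP' hQP]
    linarith
  rw [realDual, ← h1, lagrangian, h3]
  ring

end Dual


/-! ### The feasible pairs and duality at fixed `ρ` -/

section Primal

variable {X Y : Type*} [Fintype X] [Fintype Y] {L : ℕ}

/-- Pairs of distributions with a common `Y`-marginal, supported where all divergences and
logarithms are finite. -/
def pairSet (Q : X → ℝ) (W : X → Y → ℝ) (q : X → Y → ℝ) : Set ((X × Y → ℝ) × (X × Y → ℝ)) :=
  {p | p.1 ∈ stdSimplex ℝ (X × Y) ∧ p.2 ∈ stdSimplex ℝ (X × Y) ∧
    (∀ z, jointDist Q W z = 0 → p.1 z = 0) ∧ (∀ z, Q z.1 = 0 → p.2 z = 0) ∧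
    (∀ z, q z.1 z.2 = 0 → p.2 z = 0) ∧ marginalY p.2 = marginalY p.1}

lemma convex_pairSet (Q : X → ℝ) (W : X → Y → ℝ) (q : X → Y → ℝ) : Convex ℝ (pairSet Q W q) := by
  intro p hp p' hp' s t hs ht hst
  refine ⟨convex_stdSimplex ℝ _ hp.1 hp'.1 hs ht hst,
    convex_stdSimplex ℝ _ hp.2.1 hp'.2.1 hs ht hst, fun z hz => ?_, fun z hz => ?_,
    fun z hz => ?_, ?_⟩
  · simp [hp.2.2.1 z hz, hp'.2.2.1 z hz]
  · simp [hp.2.2.2.1 z hz, hp'.2.2.2.1 z hz]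
  · simp [hp.2.2.2.2.1 z hz, hp'.2.2.2.2.1 z hz]
  · ext y
    simp only [Prod.fst_add, Prod.snd_add, Prod.smul_fst, Prod.smul_snd, marginalY_combo,
      hp.2.2.2.2.2, hp'.2.2.2.2.2]

lemma isCompact_pairSet (Q : X → ℝ) (W : X → Y → ℝ) (q : X → Y → ℝ) :
    IsCompact (pairSet Q W q) := by
  have h0 : IsCompact (stdSimplex ℝ (X × Y) ×ˢ stdSimplex ℝ (X × Y)) :=
    (isCompact_stdSimplex ℝ _).prod (isCompact_stdSimplex ℝ _)
  have hz : ∀ (c : X × Y → Prop) (f : (X × Y → ℝ) × (X × Y → ℝ) → X × Y → ℝ), Continuous f →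
      IsClosed {p | ∀ z, c z → f p z = 0} := fun c f hf => by
    have : {p | ∀ z, c z → f p z = 0} = ⋂ z, ⋂ (_ : c z), {p | f p z = 0} := by
      ext p
      simp
    rw [this]
    exact isClosed_iInter fun z => isClosed_iInter fun _ =>
      isClosed_eq (by fun_prop) continuous_const
  have hm : IsClosed {p : (X × Y → ℝ) × (X × Y → ℝ) | marginalY p.2 = marginalY p.1} := by
    unfold marginalY
    exact isClosed_eq (by fun_prop) (by fun_prop)
  refine (h0.inter_right ((hz (fun z => jointDist Q W z = 0) _ continuous_fst).inter
    ((hz (fun z => Q z.1 = 0) _ continuous_snd).inter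
    ((hz (fun z => q z.1 z.2 = 0) _ continuous_snd).inter hm)))).of_isClosed_subset ?_ ?_
  · have : pairSet Q W q = (stdSimplex ℝ (X × Y) ×ˢ stdSimplex ℝ (X × Y)) ∩
        ({p | ∀ z, jointDist Q W z = 0 → p.1 z = 0} ∩ ({p | ∀ z, Q z.1 = 0 → p.2 z = 0} ∩
        ({p | ∀ z, q z.1 z.2 = 0 → p.2 z = 0} ∩ {p | marginalY p.2 = marginalY p.1}))) := by
      ext p
      simp only [pairSet, Set.mem_inter_iff, Set.mem_prod, Set.mem_ofPred_eq, and_assoc]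
    rw [this]
    exact h0.isClosed.inter ((hz (fun z => jointDist Q W z = 0) _ continuous_fst).inter
      ((hz (fun z => Q z.1 = 0) _ continuous_snd).inter
      ((hz (fun z => q z.1 z.2 = 0) _ continuous_snd).inter hm)))
  · intro p hp
    exact ⟨⟨hp.1, hp.2.1⟩, hp.2.2.1, hp.2.2.2.1, hp.2.2.2.2.1, hp.2.2.2.2.2⟩

/-- The continuous linear functional `p ↦ ∑ z, p z * c z`. -/
def pairing {α : Type*} [Fintype α] (c : α → ℝ) : (α → ℝ) →L[ℝ] ℝ :=
  ∑ z, c z • ContinuousLinearMap.proj z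

lemma pairing_apply {α : Type*} [Fintype α] (c p : α → ℝ) : pairing c p = ∑ z, p z * c z := by
  simp [pairing, mul_comm]

/-- `E_{P'}[log q] - E_P[log q]` on pairs `(P, P')`. -/
def logGap (q : X → Y → ℝ) : (X × Y → ℝ) × (X × Y → ℝ) →L[ℝ] ℝ :=
  (pairing fun z => Real.log (q z.1 z.2)).comp (ContinuousLinearMap.snd ℝ _ _) -
    (pairing fun z => Real.log (q z.1 z.2)).comp (ContinuousLinearMap.fst ℝ _ _)

/-- The cost defects of `P` (left summand) and of `P'` (right summand) on pairs `(P, P')`. -/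
def costGap (Y : Type*) [Fintype Y] (Q : X → ℝ) (a : Fin L → X → ℝ) :
    Fin L ⊕ Fin L → (X × Y → ℝ) × (X × Y → ℝ) →L[ℝ] ℝ
  | .inl l => (pairing fun z => a l z.1 - costMean Q a l).comp (ContinuousLinearMap.fst ℝ _ _)
  | .inr l => (pairing fun z => a l z.1 - costMean Q a l).comp (ContinuousLinearMap.snd ℝ _ _)

lemma logGap_apply (q : X → Y → ℝ) (p : (X × Y → ℝ) × (X × Y → ℝ)) :
    logGap q p = ∑ z, p.2 z * Real.log (q z.1 z.2) - ∑ z, p.1 z * Real.log (q z.1 z.2) := by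
  simp [logGap, pairing_apply]

lemma costGap_inl (Q : X → ℝ) (a : Fin L → X → ℝ) (l : Fin L)
    (p : (X × Y → ℝ) × (X × Y → ℝ)) :
    costGap Y Q a (.inl l) p = ∑ z, p.1 z * (a l z.1 - costMean Q a l) := by
  simp [costGap, pairing_apply]

lemma costGap_inr (Q : X → ℝ) (a : Fin L → X → ℝ) (l : Fin L)
    (p : (X × Y → ℝ) × (X × Y → ℝ)) :
    costGap Y Q a (.inr l) p = ∑ z, p.2 z * (a l z.1 - costMean Q a l) := by
  simp [costGap, pairing_apply]

lemma sum_mul_logTilt (Q : X → ℝ) (a : Fin L → X → ℝ) (r : Fin L → ℝ) (P : X × Y → ℝ) :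
    ∑ z, P z * logTilt Q a r z.1 = ∑ l, r l * ∑ z, P z * (a l z.1 - costMean Q a l) := by
  simp only [logTilt, Finset.mul_sum]
  rw [Finset.sum_comm]
  exact Finset.sum_congr rfl fun _ _ => Finset.sum_congr rfl fun _ _ => by ring

lemma sum_mul_cost_sub {Q : X → ℝ} {a : Fin L → X → ℝ} {P : X × Y → ℝ}
    (hP : P ∈ stdSimplex ℝ (X × Y)) (l : Fin L) :
    ∑ z, P z * (a l z.1 - costMean Q a l) = ∑ z, P z * a l z.1 - costMean Q a l := by
  simp only [mul_sub, Finset.sum_sub_distrib, ← Finset.sum_mul, hP.2, one_mul]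

/-- The pairs of `pairSet` that satisfy the cost and metric constraints. -/
def feasible (Q : X → ℝ) (W : X → Y → ℝ) (q : X → Y → ℝ) (a : Fin L → X → ℝ) :
    Set ((X × Y → ℝ) × (X × Y → ℝ)) :=
  {p | p ∈ pairSet Q W q ∧ 0 ≤ logGap q p ∧ ∀ i, costGap Y Q a i p = 0}

lemma convex_feasible (Q : X → ℝ) (W : X → Y → ℝ) (q : X → Y → ℝ) (a : Fin L → X → ℝ) :
    Convex ℝ (feasible Q W q a) := by
  intro p hp p' hp' s t hs ht hst
  refine ⟨convex_pairSet Q W q hp.1 hp'.1 hs ht hst, ?_, fun i => ?_⟩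
  · rw [map_add, map_smul, map_smul]
    exact add_nonneg (mul_nonneg hs hp.2.1) (mul_nonneg ht hp'.2.1)
  · rw [map_add, map_smul, map_smul, hp.2.2 i, hp'.2.2 i]
    simp

lemma isCompact_feasible (Q : X → ℝ) (W : X → Y → ℝ) (q : X → Y → ℝ) (a : Fin L → X → ℝ) :
    IsCompact (feasible Q W q a) := by
  have : feasible Q W q a =
      pairSet Q W q ∩ ({p | 0 ≤ logGap q p} ∩ ⋂ i, {p | costGap Y Q a i p = 0}) := by
    ext p
    simp only [feasible, Set.mem_inter_iff, Set.mem_iInter, Set.mem_ofPred_eq]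
  rw [this]
  exact (isCompact_pairSet Q W q).inter_right
    ((isClosed_le continuous_const (logGap q).continuous).inter
      (isClosed_iInter fun i => isClosed_eq (costGap Y Q a i).continuous continuous_const))

/-- `D(P‖Q × W) + ρ D(P'‖Q × P'_Y)` on pairs `(P, P')`. -/
def weightedObjective (Q : X → ℝ) (W : X → Y → ℝ) (ρ : ℝ) (p : (X × Y → ℝ) × (X × Y → ℝ)) : ℝ :=
  realDiv (jointDist Q W) p.1 + ρ * condDiv Q p.2

variable {Q : X → ℝ} {W : X → Y → ℝ} {q : X → Y → ℝ} {a : Fin L → X → ℝ}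

lemma continuousOn_weightedObjective (ρ : ℝ) :
    ContinuousOn (weightedObjective Q W ρ) (pairSet Q W q) := by
  refine ((continuous_realDiv _).comp continuous_fst).continuousOn.add
    (continuousOn_const.mul ((continuousOn_condDiv Q).comp continuous_snd.continuousOn ?_))
  intro p hp
  exact ⟨hp.2.1.1, hp.2.2.2.1⟩

lemma convexOn_weightedObjective (hQ : ∀ x, 0 ≤ Q x) (hN : ∀ z, 0 ≤ jointDist Q W z) {ρ : ℝ}
    (hρ : 0 ≤ ρ) : ConvexOn ℝ (pairSet Q W q) (weightedObjective Q W ρ) := by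
  refine ⟨convex_pairSet Q W q, fun p hp p' hp' s t hs ht hst => ?_⟩
  have h1 := realDiv_convex hN hp.1.1 hp'.1.1 hp.2.2.1 hp'.2.2.1 hs ht hst
  have h2 := mul_le_mul_of_nonneg_left
    (condDiv_convex hQ hp.2.1.1 hp'.2.1.1 hp.2.2.2.1 hp'.2.2.2.1 hs ht) hρ
  simp only [weightedObjective, smul_eq_mul, Prod.fst_add, Prod.snd_add, Prod.smul_fst,
    Prod.smul_snd]
  linarith

/-- This pair supplies the nonemptiness required by both minimax arguments. -/
lemma jointDist_pair_mem_feasible (hQ : Q ∈ stdSimplex ℝ X) (hW : ∀ x, W x ∈ stdSimplex ℝ Y)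
    (hNq : ∀ z, jointDist Q W z ≠ 0 → 0 < q z.1 z.2) :
    (jointDist Q W, jointDist Q W) ∈ feasible Q W q a := by
  have hN := jointDist_mem hQ hW
  have hc : ∀ l, ∑ z, jointDist Q W z * (a l z.1 - costMean Q a l) = 0 := fun l => by
    rw [sum_mul_cost_sub hN, sum_jointDist_mul_fst hW, costMean, sub_self]
  refine ⟨⟨hN, hN, fun z hz => hz, fun z hz => by simp [jointDist, hz], fun z hz => ?_, rfl⟩, ?_, ?_⟩
  · by_contra h
    exact (hNq z h).ne' hz
  · simp [logGap_apply]
  · rintro (l | l)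
    · rw [costGap_inl, hc]
    · rw [costGap_inr, hc]

/-- On a feasible pair the cost terms of the Lagrangian vanish and the metric term is `-ρ s` times a
nonnegative gap, so weak duality applies for all multipliers at once. -/
lemma E0cost_le_weightedObjective (hQ : Q ∈ stdSimplex ℝ X) (hW : ∀ x, W x ∈ stdSimplex ℝ Y)
    (hq : ∀ x y, 0 ≤ q x y) (hNq : ∀ z, jointDist Q W z ≠ 0 → 0 < q z.1 z.2) {ρ : ℝ} (hρ : 0 ≤ ρ)
    {p : (X × Y → ℝ) × (X × Y → ℝ)} (hp : p ∈ feasible Q W q a) :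
    E0cost Q W q ρ a ≤ (weightedObjective Q W ρ p : EReal) := by
  refine iSup₂_le fun s hs => iSup₂_le fun r rbar => ?_
  have hN := jointDist_mem hQ hW
  rw [dualObjective_eq_realDual hQ.1 hq hN ρ r rbar fun z hz => Or.inr (hNq z hz),
    EReal.coe_le_coe_iff]
  obtain ⟨⟨h1, h2, h3, h4, h5, h6⟩, h7, h8⟩ := hp
  refine (realDual_le_lagrangian hQ.1 hq hN hρ r rbar h1 h3 h2.1 h4
    (fun z hz => Or.inr ((hq _ _).lt_of_ne fun h => hz (h5 z h.symm))) h6).trans ?_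
  have e1 : ∀ l, ∑ z, p.1 z * (a l z.1 - costMean Q a l) = 0 := fun l => by
    rw [← costGap_inl, h8]
  have e2 : ∀ l, ∑ z, p.2 z * (a l z.1 - costMean Q a l) = 0 := fun l => by
    rw [← costGap_inr, h8]
  rw [lagrangian, weightedObjective, sum_mul_logTilt, sum_mul_logTilt, ← logGap_apply]
  simp only [e1, e2, mul_zero, Finset.sum_const_zero, add_zero, sub_zero]
  have := mul_nonneg hρ (mul_nonneg hs h7)
  linarith

/-- The zeroth power of the ratio is `1` even where the ratio is infinite, so only the total mass of
`Q×W` remains. -/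
lemma dualObjective_rho_zero (hQ : Q ∈ stdSimplex ℝ X) (hW : ∀ x, W x ∈ stdSimplex ℝ Y) (s : ℝ)
    (r rbar : Fin L → ℝ) : dualObjective Q W q 0 a s r rbar = 0 := by
  have hN := jointDist_mem hQ hW
  rw [dualObjective, ← Fintype.sum_prod_type
    (f := fun z => ENNReal.ofReal (Q z.1 * W z.1 z.2) * dualRatio Q q a s r rbar z.1 z.2 ^ (0 : ℝ))]
  simp only [ENNReal.rpow_zero, mul_one]
  rw [← ENNReal.ofReal_sum_of_nonneg fun (z : X × Y) _ =>
    show 0 ≤ Q z.1 * W z.1 z.2 from hN.1 z]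
  have : ∑ z : X × Y, Q z.1 * W z.1 z.2 = 1 := hN.2
  simp [this]

lemma E0cost_zero (hQ : Q ∈ stdSimplex ℝ X) (hW : ∀ x, W x ∈ stdSimplex ℝ Y) :
    E0cost Q W q 0 a = 0 := by
  refine le_antisymm (iSup₂_le fun s _ => iSup₂_le fun r rbar =>
    (dualObjective_rho_zero hQ hW s r rbar).le) ?_
  rw [← dualObjective_rho_zero (q := q) (a := a) hQ hW 0 0 0]
  exact (le_iSup₂ (f := fun r rbar => dualObjective Q W q 0 a 0 r rbar) 0 0).trans
    (le_iSup₂ (f := fun (s : ℝ) (_ : 0 ≤ s) => ⨆ (r : Fin L → ℝ) (rbar : Fin L → ℝ),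
      dualObjective Q W q 0 a s r rbar) 0 le_rfl)

/-- Strong duality. -/
lemma le_E0cost (hQ : Q ∈ stdSimplex ℝ X) (hW : ∀ x, W x ∈ stdSimplex ℝ Y)
    (hq : ∀ x y, 0 ≤ q x y) (hNq : ∀ z, jointDist Q W z ≠ 0 → 0 < q z.1 z.2) {ρ : ℝ} (hρ : 0 ≤ ρ)
    {m : ℝ} (hm : ∀ p ∈ feasible Q W q a, m ≤ weightedObjective Q W ρ p) :
    (m : EReal) ≤ E0cost Q W q ρ a := by
  have hN := jointDist_mem hQ hW
  have hNN := jointDist_pair_mem_feasible (a := a) hQ hW hNq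
  -- The case `ρ = 0` is separate because the multipliers are divided by `ρ` below; there the pair
  -- `(Q×W, Q×W)` gives `m ≤ 0`.
  rcases hρ.eq_or_lt with rfl | hρ
  · rw [E0cost_zero hQ hW]
    simpa [weightedObjective, realDiv_self] using hm _ hNN
  refine EReal.ge_of_forall_gt_iff_ge.1 fun c hc => ?_
  obtain ⟨s, hs, t, ht⟩ := exists_multipliers ⟨_, hNN.1⟩ (convex_pairSet Q W q)
    (isCompact_pairSet Q W q) (convexOn_weightedObjective hQ.1 hN.1 hρ.le)
    (continuousOn_weightedObjective ρ) (logGap q) (costGap Y Q a)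
    (fun p hp h1 h2 => hm p ⟨hp, h1, h2⟩) (EReal.coe_lt_coe_iff.1 hc)
  -- In `lagrangian` the factor `ρ` multiplies every constraint term, and the cost of `P'` enters
  -- with a minus sign; hence the rescaling and the sign of the second family.
  have hsρ : 0 < s / ρ := div_pos hs hρ
  obtain ⟨P, hP, P', hP', h1, h2, h3, h4, h5⟩ := exists_lagrangian_eq_realDual (a := a) hQ.1 hq hN ρ
    hsρ (fun l => t (.inl l) / ρ) (fun l => -t (.inr l) / ρ) hNq
  have h6 := ht (P, P') ⟨hP, hP', h1, h2, h3, h4⟩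
  have h7 : c ≤ realDual Q W q ρ a (s / ρ) (fun l => t (.inl l) / ρ)
      (fun l => -t (.inr l) / ρ) := by
    rw [← h5, lagrangian, sum_mul_logTilt, sum_mul_logTilt]
    simp only [Fintype.sum_sum_type, costGap_inl, costGap_inr, logGap_apply,
      weightedObjective] at h6
    refine h6.trans (le_of_eq ?_)
    simp only [div_mul_eq_mul_div, ← Finset.sum_div, neg_mul, Finset.sum_neg_distrib]
    field_simp
    ring
  refine (EReal.coe_le_coe_iff.2 h7).trans ?_
  rw [← dualObjective_eq_realDual hQ.1 hq hN ρ _ _ fun z hz => Or.inr (hNq z hz)]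
  exact (le_iSup₂ (f := fun r rbar => dualObjective Q W q ρ a (s / ρ) r rbar) _ _).trans
    (le_iSup₂ (f := fun (s : ℝ) (_ : 0 ≤ s) => ⨆ (r : Fin L → ℝ) (rbar : Fin L → ℝ),
      dualObjective Q W q ρ a s r rbar) (s / ρ) hsρ.le)

end Primal


/-! ### Saddle point and the theorem for `q` positive on the support -/

section Correspondence

variable {X Y : Type*} [Fintype X] [Fintype Y] {L : ℕ}
variable {Q : X → ℝ} {W : X → Y → ℝ} {q : X → Y → ℝ} {a : Fin L → X → ℝ}

lemma primalObjective_eq_of_mem_pairSet (R : ℝ) {p : (X × Y → ℝ) × (X × Y → ℝ)}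
    (hp : p ∈ pairSet Q W q) :
    primalObjective Q W R p.1 p.2 =
      ((realDiv (jointDist Q W) p.1 + max 0 (condDiv Q p.2 - R) : ℝ) : EReal) := by
  obtain ⟨-, h2, h3, h4, -, h6⟩ := hp
  rw [primalObjective, relEntropy_eq_realDiv h3, relEntropy_eq_condDiv h2.1 h4 h6, EReal.coe_add,
    EReal.coe_strictMono.monotone.map_max, EReal.coe_sub, EReal.coe_zero]

lemma mem_of_mem_feasible (hNq : ∀ z, jointDist Q W z ≠ 0 → 0 < q z.1 z.2)
    {p : (X × Y → ℝ) × (X × Y → ℝ)} (hp : p ∈ feasible Q W q a) :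
    p.1 ∈ setS Y Q a ∧ p.2 ∈ setT Q q a p.1 := by
  obtain ⟨⟨h1, h2, h3, h4, h5, h6⟩, h7, h8⟩ := hp
  refine ⟨⟨h1, fun l => ?_⟩, h2, fun l => ?_, h6, ?_⟩
  · rw [← sub_eq_zero, ← sum_mul_cost_sub h1, ← costGap_inl, h8]
  · rw [← sub_eq_zero, ← sum_mul_cost_sub h2, ← costGap_inr, h8]
  · rw [expectLog_of_support, expectLog_of_support h5, EReal.coe_le_coe_iff]
    · rw [logGap_apply] at h7
      exact sub_nonneg.1 h7
    · intro z hz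
      by_contra h
      exact (hNq z fun h' => h (h3 z h')).ne' hz

/-- A finite objective gives `P ≪ Q×W`, so `q > 0` on the support of `P` and `E_P[log q]` is finite.
The metric constraint then keeps `E_{P'}[log q]` above `-∞`, so `P'` avoids the zeros of `q`. -/
lemma mem_feasible_of_ne_top (hNq : ∀ z, jointDist Q W z ≠ 0 → 0 < q z.1 z.2) {R : ℝ}
    {P P' : X × Y → ℝ} (hP : P ∈ setS Y Q a) (hP' : P' ∈ setT Q q a P)
    (h : primalObjective Q W R P P' ≠ ⊤) : (P, P') ∈ feasible Q W q a := by
  obtain ⟨h1, h2⟩ := hP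
  obtain ⟨h3, h4, h5, h6⟩ := hP'
  have hN : ∀ z, jointDist Q W z = 0 → P z = 0 := by
    by_contra hc
    refine h ?_
    rw [primalObjective, relEntropy, if_neg hc]
    exact EReal.top_add_of_ne_bot (EReal.bot_lt_zero.trans_le (le_max_left _ _)).ne'
  have hQ' : ∀ z, prodDist Q (marginalY P) z = 0 → P' z = 0 := by
    by_contra hc
    refine h ?_
    rw [primalObjective, relEntropy_eq_realDiv hN, relEntropy, if_neg hc, EReal.top_sub_coe,
      max_eq_right le_top, EReal.coe_add_top]
  have hqP : ∀ z : X × Y, q z.1 z.2 = 0 → P z = 0 := fun z hz => by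
    by_contra h
    exact (hNq z fun h' => h (hN z h')).ne' hz
  have hqP' : ∀ z : X × Y, q z.1 z.2 = 0 → P' z = 0 := by
    by_contra hc
    rw [expectLog_of_support hqP, expectLog, if_neg hc] at h6
    exact EReal.coe_ne_bot _ (le_bot_iff.1 h6)
  rw [expectLog_of_support hqP, expectLog_of_support hqP', EReal.coe_le_coe_iff] at h6
  refine ⟨⟨h1, h3, hN, fun z hz => hQ' z (by simp [prodDist, hz]), hqP', h5⟩, ?_, ?_⟩
  · rw [logGap_apply]
    exact sub_nonneg.2 h6
  · rintro (l | l)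
    · rw [costGap_inl]
      exact (sum_mul_cost_sub h1 l).trans (sub_eq_zero.2 (h2 l))
    · rw [costGap_inr]
      exact (sum_mul_cost_sub h3 l).trans (sub_eq_zero.2 (h4 l))

/-- Both the feasible set and `[0,1]` are compact and convex, and the function is continuous and
convex in the pair, affine in `ρ`. -/
lemma exists_saddlePoint (hQ : Q ∈ stdSimplex ℝ X) (hW : ∀ x, W x ∈ stdSimplex ℝ Y)
    (hNq : ∀ z, jointDist Q W z ≠ 0 → 0 < q z.1 z.2) (R : ℝ) :
    ∃ p ∈ feasible Q W q a, ∃ ρ ∈ Set.Icc (0 : ℝ) 1, ∀ p' ∈ feasible Q W q a,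
      ∀ ρ' ∈ Set.Icc (0 : ℝ) 1,
        weightedObjective Q W ρ' p - ρ' * R ≤ weightedObjective Q W ρ p' - ρ * R := by
  have hN := jointDist_mem hQ hW
  have hsub : feasible Q W q a ⊆ pairSet Q W q := fun p hp => hp.1
  obtain ⟨p, hp, ρ, hρ, h⟩ := Sion.exists_isSaddlePointOn (X := feasible Q W q a)
    (Y := Set.Icc (0 : ℝ) 1) (f := fun p ρ => weightedObjective Q W ρ p - ρ * R)
    ⟨_, jointDist_pair_mem_feasible hQ hW hNq⟩ (convex_feasible Q W q a)
    (isCompact_feasible Q W q a)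
    (fun ρ _ => (((continuousOn_weightedObjective ρ).mono hsub).sub
      continuousOn_const).lowerSemicontinuousOn)
    (fun ρ hρ => (((convexOn_weightedObjective hQ.1 hN.1 hρ.1).subset hsub
      (convex_feasible Q W q a)).sub (concaveOn_const (ρ * R)
        (convex_feasible Q W q a))).quasiconvexOn)
    (convex_Icc 0 1) ⟨0, by simp⟩ isCompact_Icc
    (fun p _ => by
      refine Continuous.upperSemicontinuous ?_ |>.upperSemicontinuousOn _
      unfold weightedObjective
      fun_prop)
    (fun p _ => by
      refine ConcaveOn.quasiconcaveOn ⟨convex_Icc 0 1, fun ρ₁ _ ρ₂ _ s t _ _ hst => le_of_eq ?_⟩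
      obtain rfl : t = 1 - s := by linarith
      simp only [weightedObjective, smul_eq_mul]
      ring)
  exact ⟨p, hp, ρ, hρ, fun p' hp' ρ' hρ' => h p' hp' ρ' hρ'⟩

/-- The duality theorem when `q` is positive on the support of `Q × W`. -/
lemma duality_of_pos (hQ : Q ∈ stdSimplex ℝ X) (hW : ∀ x, W x ∈ stdSimplex ℝ Y)
    (hq : ∀ x y, 0 ≤ q x y) (hNq : ∀ z, jointDist Q W z ≠ 0 → 0 < q z.1 z.2) (R : ℝ) :
    (∃ P ∈ setS Y Q a, ∃ P' ∈ setT Q q a P, primalObjective Q W R P P' = Ercost Q W q R a) ∧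
    IsGreatest ((fun ρ : ℝ => E0cost Q W q ρ a - ((ρ * R : ℝ) : EReal)) '' Set.Icc 0 1)
      (Ercost Q W q R a) := by
  obtain ⟨p, hp, ρ, hρ, hsad⟩ := exists_saddlePoint (a := a) hQ hW hNq R
  set v := weightedObjective Q W ρ p - ρ * R with hv
  have hmax : ∀ p : (X × Y → ℝ) × (X × Y → ℝ), weightedObjective Q W ρ p - ρ * R ≤
      realDiv (jointDist Q W) p.1 + max 0 (condDiv Q p.2 - R) := fun p => by
    have h1 : ρ * (condDiv Q p.2 - R) ≤ max 0 (condDiv Q p.2 - R) := by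
      rcases le_total 0 (condDiv Q p.2 - R) with h | h
      · rw [max_eq_right h]
        exact mul_le_of_le_one_left h hρ.2
      · exact (mul_nonpos_of_nonneg_of_nonpos hρ.1 h).trans (le_max_left _ _)
    rw [weightedObjective]
    linarith
  -- Comparing the saddle value with `ρ' = 0` and `ρ' = 1` bounds both branches of the maximum by
  -- `v`.
  have hpv : realDiv (jointDist Q W) p.1 + max 0 (condDiv Q p.2 - R) = v := by
    refine le_antisymm ?_ (hmax p)
    have h0 := hsad p hp 0 (by simp)
    have h1 := hsad p hp 1 (by simp)
    simp only [weightedObjective] at h0 h1 hv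
    rcases max_choice 0 (condDiv Q p.2 - R) with h | h <;> rw [h] <;> linarith
  have hobj : primalObjective Q W R p.1 p.2 = (v : EReal) := by
    rw [primalObjective_eq_of_mem_pairSet R hp.1, hpv]
  obtain ⟨hS, hT⟩ := mem_of_mem_feasible hNq hp
  have hEr : Ercost Q W q R a = (v : EReal) := by
    refine le_antisymm ?_ (le_iInf₂ fun P hP => le_iInf₂ fun P' hP' => ?_)
    · exact ((iInf₂_le p.1 hS).trans (iInf₂_le p.2 hT)).trans hobj.le
    · by_cases htop : primalObjective Q W R P P' = ⊤
      · rw [htop]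
        exact le_top
      · have hmem := mem_feasible_of_ne_top hNq hP hP' htop
        rw [primalObjective_eq_of_mem_pairSet R hmem.1, EReal.coe_le_coe_iff]
        exact (hsad _ hmem ρ hρ).trans (hmax _)
  have hle : ∀ ρ' ∈ Set.Icc (0 : ℝ) 1,
      E0cost Q W q ρ' a - ((ρ' * R : ℝ) : EReal) ≤ (v : EReal) := fun ρ' hρ' => by
    refine (EReal.sub_le_sub (E0cost_le_weightedObjective hQ hW hq hNq hρ'.1 hp) le_rfl).trans ?_
    rw [← EReal.coe_sub, EReal.coe_le_coe_iff]
    exact hsad p hp ρ' hρ'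
  refine ⟨⟨p.1, hS, p.2, hT, hobj.trans hEr.symm⟩, ⟨ρ, hρ, ?_⟩, ?_⟩
  · rw [hEr]
    refine le_antisymm (hle ρ hρ) ?_
    -- The saddle inequality at `ρ' = ρ` says that `v + ρ * R` bounds the weighted objective from
    -- below on all feasible pairs.
    have h := le_E0cost (a := a) hQ hW hq hNq hρ.1 (m := v + ρ * R) fun p' hp' => by
      linarith [hsad p' hp' ρ hρ]
    refine le_trans (le_of_eq ?_) (EReal.sub_le_sub h le_rfl)
    rw [← EReal.coe_sub, add_sub_cancel_right]
  · rintro _ ⟨ρ', hρ', rfl⟩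
    rw [hEr]
    exact hle ρ' hρ'

end Correspondence

/-! ### The case where `q` vanishes on the support of `Q×W` -/

section Degenerate

variable {X Y : Type*} [Fintype X] [Fintype Y] {L : ℕ}
variable {Q : X → ℝ} {W : X → Y → ℝ} {q : X → Y → ℝ} {a : Fin L → X → ℝ}

lemma sum_mul_cost_sub_self (hQ : Q ∈ stdSimplex ℝ X) (l : Fin L) :
    ∑ x, Q x * (a l x - costMean Q a l) = 0 := by
  simp only [mul_sub, Finset.sum_sub_distrib, ← Finset.sum_mul, hQ.2, one_mul]
  exact sub_self _

lemma sum_prodDist_mul_logTilt (hQ : Q ∈ stdSimplex ℝ X) {V : Y → ℝ} (hV : V ∈ stdSimplex ℝ Y)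
    (r : Fin L → ℝ) : ∑ z, prodDist Q V z * logTilt Q a r z.1 = 0 := by
  rw [sum_mul_logTilt]
  refine Finset.sum_eq_zero fun l _ => ?_
  rw [sum_prodDist_mul_fst hV fun x => a l x - costMean Q a l, sum_mul_cost_sub_self hQ, mul_zero]

lemma sum_jointDist_mul_logTilt (hQ : Q ∈ stdSimplex ℝ X) (hW : ∀ x, W x ∈ stdSimplex ℝ Y)
    (r : Fin L → ℝ) : ∑ z, jointDist Q W z * logTilt Q a r z.1 = 0 := by
  rw [sum_mul_logTilt]
  refine Finset.sum_eq_zero fun l _ => ?_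
  rw [sum_jointDist_mul_fst hW fun x => a l x - costMean Q a l, sum_mul_cost_sub_self hQ, mul_zero]

/-- A zero of `q` on the support of `Q × W` forces `s = 0`, and the dual value vanishes. -/
lemma E0cost_eq_zero (hQ : Q ∈ stdSimplex ℝ X) (hW : ∀ x, W x ∈ stdSimplex ℝ Y)
    (hq : ∀ x y, 0 ≤ q x y) {z : X × Y} (hz : jointDist Q W z ≠ 0) (hqz : q z.1 z.2 = 0)
    {ρ : ℝ} (hρ : 0 ≤ ρ) : E0cost Q W q ρ a = 0 := by
  have hN := jointDist_mem hQ hW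
  rcases hρ.eq_or_lt with rfl | hρ
  · exact E0cost_zero hQ hW
  refine le_antisymm (iSup₂_le fun s hs => iSup₂_le fun r rbar => ?_) ?_
  · rcases hs.eq_or_lt with rfl | hs
    · rw [dualObjective_eq_realDual hQ.1 hq hN ρ r rbar fun z _ => Or.inl rfl]
      have hM := marginalY_mem hN
      have hmar := marginalY_prodDist hQ (marginalY (jointDist Q W))
      -- At `s = 0` weak duality is tested on `P = Q×W` and `P' = Q×P_Y`: both divergences and both
      -- cost terms are zero.
      have h := realDual_le_lagrangian (a := a) hQ.1 hq hN hρ.le r rbar hN (fun z hz => hz)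
        (prodDist_mem hQ hM).1 (fun z hz => by simp [prodDist, hz]) (fun z _ => Or.inl rfl) hmar
      refine (EReal.coe_le_coe_iff.2 h).trans (le_of_eq ?_)
      rw [lagrangian, condDiv, hmar, realDiv_self, realDiv_self, sum_prodDist_mul_logTilt hQ hM,
        sum_jointDist_mul_logTilt hQ hW]
      simp
    · have htop : ∑ x, ∑ y, ENNReal.ofReal (Q x * W x y) *
          dualRatio Q q a s r rbar x y ^ ρ = ⊤ := by
        rw [ENNReal.sum_eq_top]
        refine ⟨z.1, Finset.mem_univ _, ENNReal.sum_eq_top.2 ⟨z.2, Finset.mem_univ _, ?_⟩⟩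
        rw [dualRatio, if_pos (by rw [hqz, Real.zero_rpow hs.ne', zero_mul]),
          ENNReal.top_rpow_of_pos hρ]
        exact ENNReal.mul_top
          (ENNReal.ofReal_pos.2 ((hN.1 z).lt_of_ne hz.symm)).ne'
      rw [dualObjective, htop, ENNReal.log_top, EReal.neg_top]
      exact bot_le
  -- With all parameters zero the ratio is identically `1`.
  · have h : dualObjective Q W q ρ a 0 0 0 = 0 := by
      rw [dualObjective_eq_realDual hQ.1 hq hN ρ 0 0 fun z _ => Or.inl rfl, realDual]
      have hs : ∑ x, Q x = 1 := hQ.2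
      have hs' : ∑ z, jointDist Q W z = 1 := hN.2
      simp [dualLogRatio, condTerm, logTilt, tilt, hs, hs']
    rw [← h]
    exact (le_iSup₂ (f := fun r rbar => dualObjective Q W q ρ a 0 r rbar) 0 0).trans
      (le_iSup₂ (f := fun (s : ℝ) (_ : 0 ≤ s) => ⨆ (r : Fin L → ℝ) (rbar : Fin L → ℝ),
        dualObjective Q W q ρ a s r rbar) 0 le_rfl)

/-- The duality theorem when `q` vanishes somewhere on the support of `Q × W`. -/
lemma duality_of_zero (hQ : Q ∈ stdSimplex ℝ X) (hW : ∀ x, W x ∈ stdSimplex ℝ Y)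
    (hq : ∀ x y, 0 ≤ q x y) {z : X × Y} (hz : jointDist Q W z ≠ 0) (hqz : q z.1 z.2 = 0) (R : ℝ) :
    (∃ P ∈ setS Y Q a, ∃ P' ∈ setT Q q a P, primalObjective Q W R P P' = Ercost Q W q R a) ∧
    IsGreatest ((fun ρ : ℝ => E0cost Q W q ρ a - ((ρ * R : ℝ) : EReal)) '' Set.Icc 0 1)
      (Ercost Q W q R a) := by
  have hN := jointDist_mem hQ hW
  have hM := marginalY_mem hN
  have hS : jointDist Q W ∈ setS Y Q a :=
    ⟨hN, fun l => sum_jointDist_mul_fst hW (a l)⟩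
  -- Since `E_P[log q] = -∞` for `P = Q×W`, the metric constraint is void and `P'` can be the
  -- product, making both divergences zero.
  have hT : prodDist Q (marginalY (jointDist Q W)) ∈ setT Q q a (jointDist Q W) := by
    refine ⟨prodDist_mem hQ hM, fun l => sum_prodDist_mul_fst hM (a l),
      marginalY_prodDist hQ _, ?_⟩
    rw [expectLog, if_neg fun h => hz (h z hqz)]
    exact bot_le
  have hobj : primalObjective Q W R (jointDist Q W) (prodDist Q (marginalY (jointDist Q W))) =
      ((max 0 (-R) : ℝ) : EReal) := by
    rw [primalObjective, relEntropy_eq_realDiv fun z hz => hz,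
      relEntropy_eq_realDiv fun z hz => hz, realDiv_self, realDiv_self,
      EReal.coe_strictMono.monotone.map_max]
    simp
  have hEr : Ercost Q W q R a = ((max 0 (-R) : ℝ) : EReal) := by
    refine le_antisymm ?_ (le_iInf₂ fun P hP => le_iInf₂ fun P' hP' => ?_)
    · exact ((iInf₂_le _ hS).trans (iInf₂_le _ hT)).trans hobj.le
    · have h1 := relEntropy_nonneg hN hP.1
      have h2 := EReal.sub_le_sub
        (relEntropy_nonneg (prodDist_mem hQ (marginalY_mem hP.1)) hP'.1) (le_refl (R : EReal))
      rw [zero_sub] at h2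
      rw [EReal.coe_strictMono.monotone.map_max, EReal.coe_neg, EReal.coe_zero]
      exact (max_le_max_left 0 h2).trans (le_add_of_nonneg_left h1)
  have hval : ∀ ρ ∈ Set.Icc (0 : ℝ) 1,
      E0cost Q W q ρ a - ((ρ * R : ℝ) : EReal) = ((-(ρ * R) : ℝ) : EReal) := fun ρ hρ => by
    rw [E0cost_eq_zero hQ hW hq hz hqz hρ.1, zero_sub, EReal.coe_neg]
  refine ⟨⟨_, hS, _, hT, hobj.trans hEr.symm⟩, ?_, ?_⟩
  -- The maximum of `-ρ R` on `[0,1]` sits at `ρ = 0` or `ρ = 1` according to the sign of `R`.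
  · rcases le_total 0 R with hR | hR
    · refine ⟨0, by simp, ?_⟩
      rw [hEr, max_eq_left (by linarith)]
      exact (hval 0 (by simp)).trans (by simp)
    · refine ⟨1, by simp, ?_⟩
      rw [hEr, max_eq_right (by linarith)]
      exact (hval 1 (by simp)).trans (by simp)
  · rintro _ ⟨ρ, hρ, rfl⟩
    rw [hEr]
    refine (hval ρ hρ).le.trans (EReal.coe_le_coe_iff.2 ?_)
    rcases le_total 0 R with hR | hR
    · exact le_max_of_le_left (by nlinarith [hρ.1])
    · exact le_max_of_le_right (by nlinarith [hρ.2])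

end Degenerate

end CostExponent

end

theorem theorem3 {X Y : Type*} [Fintype X] [Fintype Y]
    (Q : X → ℝ) (hQ : Q ∈ stdSimplex ℝ X)
    (W : X → Y → ℝ) (hW : ∀ x, W x ∈ stdSimplex ℝ Y)
    (q : X → Y → ℝ) (hq : ∀ x y, 0 ≤ q x y)
    {L : ℕ} (a : Fin L → X → ℝ) (R : ℝ) :
    (∃ P ∈ CostExponent.setS Y Q a, ∃ P' ∈ CostExponent.setT Q q a P,
      CostExponent.primalObjective Q W R P P' = CostExponent.Ercost Q W q R a) ∧
    IsGreatest
      ((fun ρ : ℝ => CostExponent.E0cost Q W q ρ a - ((ρ * R : ℝ) : EReal)) '' Set.Icc 0 1)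
      (CostExponent.Ercost Q W q R a) := by
  by_cases h : ∃ z, CostExponent.jointDist Q W z ≠ 0 ∧ q z.1 z.2 = 0
  · obtain ⟨z, hz, hqz⟩ := h
    exact CostExponent.duality_of_zero hQ hW hq hz hqz R
  · exact CostExponent.duality_of_pos hQ hW hq
      (fun z hz => (hq _ _).lt_of_ne fun h0 => h ⟨z, hz, h0.symm⟩) R
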